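/- Let $N,K,B\ge 1$ and $M=2^{KB}$. A symbol $s$, uniformly distributed on an $M$-ary constellation $\mathcal S_\rho=\{\sqrt{\rho}\,x_1,\dots,\sqrt{\rho}\,x_M\}\subset\mathbb C$, where $x_1,\dots,x_M$ are fixed distinct points with $\sum_m x_m=0$ and $\frac1M\sum_m|x_m|^2=1$ (so that $E[s]=0$, $E[|s|^2]=\rho$), is observed at $N$ nodes as $y_i=h_is+n_i$, $i=1,\dots,N$, where $h_1,\dots,h_N,n_1,\dots,n_N$ are i.i.d. $\mathcal{CN}(0,1)$ and independent of $s$. The constellation points are labelled bijectively by vectors $\mathbf a(s)\in GF(2^B)^K$. Given a generator matrix $\mathbf G\in GF(2^B)^{K\times N}$ with columns $\mathbf g_1^T,\dots,\mathbf g_N^T$ (the processing rules of the nodes), node $i$, which knows $h_i$ and $y_i$, makes the minimum distance decision $\widehat s_i\in\arg\min_{s'\in\mathcal S_\rho}|y_i-h_is'|$ and sends $u_i=\mathbf a(\widehat s_i)\mathbf g_i^T\in GF(2^B)$ without error to a fusion center that knows $h_1,\dots,h_N$. Put $\mathbf c(s)=\mathbf a(s)\mathbf G$ and $d_{\min}(\mathcal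 C)=\min_{s\ne s'}d_H(\mathbf c(s),\mathbf c(s'))$, where $d_H$ is the Hamming distance and the minimum is over pairs of distinct symbols; for $L\le N$ let $d_{\min}(\mathcal C_L)$ be the same quantity for the matrix formed by the first $L$ columns of $\mathbf G$. Full ML decoding chooses $\widehat s\in\arg\max_{s}\prod_{i=1}^N \Pr(u_i\mid s,h_i)$. Suppose that every $L$-th node shares the same processing rule ($\mathbf g_i=\mathbf g_k$ whenever $i\equiv k \pmod L$) and that $\mathbf g_1,\dots,\mathbf g_L$ are pairwise distinct. Selected subset ML decoding selects, in each group $\mathcal I_j=\{j,j+L,j+2L,\dots\}\cap\{1,\dots,N\}$, $j=1,\dots,L$, a node $j^\dagger\in\arg\max_{k\in\mathcal I_j}|h_k|^2$, and chooses $\widehat s\in\arg\max_s\prod_{j=1}^L\Pr(u_{j^\dagger}\mid s,h_{j^\dagger})$. All ties are broken in an arbitrary measurable way. A scheme with symbol error probability $P_e(\rho)=\Pr(\widehat s\ne s)$ (averaged over symbol, channels and noise) has diversity order $d$ if $P_e(\rho)>0$ for all large $\rho$ and $-\lim_{\rho\to\infty}\log P_e(\rho)/\log\rho=d$. If $L$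 divides $N$, then $d_{\min}(\mathcal C)=\frac NL\,d_{\min}(\mathcal C_L)$, and selected subset ML decoding has diversity order $d_{\min}(\mathcal C)$, the same as full ML decoding. -/

import Mathlib

open MeasureTheory Filter Topology
open scoped Matrix

namespace CodedDiversity

noncomputable section

/-- The circularly symmetric complex Gaussian law `CN(0,1)`: density `exp (-|z|^2) / π` with
respect to Lebesgue measure on `ℂ`. -/
def complexGaussian : Measure ℂ :=
  volume.withDensity fun z => ENNReal.ofReal (Real.exp (-‖z‖ ^ 2) / Real.pi)

/-- The alphabet `GF(2^B)` of the bits sent by a node. -/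
abbrev GF (B : ℕ) : Type := GaloisField 2 B

/-- A coded distributed diversity system with `N` receive nodes, an `M`-ary constellation, and
`B` bits per node with compression ratio `K`.  The constellation at signal-to-noise ratio `ρ` is
`√ρ` times the normalized constellation `point`. -/
structure System (N M K B : ℕ) where
  /-- the normalized constellation points -/
  point : Fin M → ℂ
  point_injective : Function.Injective point
  /-- `E[s] = 0` for a uniformly distributed symbol -/
  mean_zero : ∑ m, point m = 0
  /-- `E[|s|^2] = 1` for the normalized constellation, hence `ρ` after scaling by `√ρ` -/
  unit_energy : (∑ m, ‖point m‖ ^ 2) / (M : ℝ) = 1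
  /-- the message vector `a ∈ GF(2^B)^K` represented by a constellation point -/
  label : Fin M ≃ (Fin K → GF B)
  /-- the generator matrix, whose `i`-th column is the processing rule of node `i` -/
  gen : Matrix (Fin K) (Fin N) (GF B)

/-- The codeword `c(s_m) = a G` for the generator matrix `G`. -/
def codeword {M K B n : ℕ} (label : Fin M ≃ (Fin K → GF B)) (G : Matrix (Fin K) (Fin n) (GF B))
    (m : Fin M) : Fin n → GF B :=
  label m ᵥ* G

open scoped Classical in
/-- The minimum Hamming distance `min_{s ≠ s'} d_H(c(s), c(s'))` of the code generated by `G`.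
The minimum runs over pairs of distinct symbols, so it is `0` if two symbols share a codeword. -/
def minDist {M K B n : ℕ} (label : Fin M ≃ (Fin K → GF B))
    (G : Matrix (Fin K) (Fin n) (GF B)) : ℕ :=
  sInf {d | ∃ m m' : Fin M, m ≠ m' ∧ d = hammingDist (codeword label G m) (codeword label G m')}

namespace System

variable {N M K B : ℕ}

/-- The transmitted symbol `s_m` at signal-to-noise ratio `ρ`. -/
def symbol (S : System N M K B) (ρ : ℝ) (m : Fin M) : ℂ :=
  (Real.sqrt ρ : ℂ) * S.point m

/-- The processing function `f_i(a) = a g_i^T` of node `i`. -/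
def rule (S : System N M K B) (i : Fin N) (a : Fin K → GF B) : GF B :=
  a ⬝ᵥ S.gen.col i

/-- `d_min(C)`, for the code of all `N` nodes. -/
def dMin (S : System N M K B) : ℕ :=
  minDist S.label S.gen

/-- `d_min(C_L)`, for the code generated by the first `L` columns of the generator matrix. -/
def dMinFirst (S : System N M K B) (L : ℕ) (hL : L ≤ N) : ℕ :=
  minDist S.label (S.gen.submatrix id (Fin.castLE hL))

/-- Every `L`-th node shares the same processing rule, and the rules of the first `L` nodes are
pairwise distinct. -/
def RulesRepeat (S : System N M K B) (L : ℕ) : Prop :=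
  (∀ i k : Fin N, (i : ℕ) % L = (k : ℕ) % L → S.gen.col i = S.gen.col k) ∧
  (∀ i k : Fin N, (i : ℕ) < L → (k : ℕ) < L → i ≠ k → S.gen.col i ≠ S.gen.col k)

end System

/-- Minimum distance hard detectors at the nodes, at signal-to-noise ratio `ρ`: node `i`, knowing
its channel `h` and its observation `y`, picks a symbol minimizing `|y - h s|` (for `h ≠ 0` this
is the same as minimizing `|y / h - s|`).  Ties are broken in any measurable way. -/
structure NodeDetectors {N M K B : ℕ} (S : System N M K B) (ρ : ℝ) where
  detect : Fin N → ℂ → ℂ → Fin M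
  measurable_detect : ∀ i, Measurable fun p : ℂ × ℂ => detect i p.1 p.2
  detect_min : ∀ i h y m,
    ‖y - h * S.symbol ρ (detect i h y)‖ ≤ ‖y - h * S.symbol ρ m‖

namespace NodeDetectors

variable {N M K B : ℕ} {S : System N M K B} {ρ : ℝ}

/-- The value `u_i` that node `i` sends to the fusion center. -/
def output (D : NodeDetectors S ρ) (i : Fin N) (h y : ℂ) : GF B :=
  S.rule i (S.label (D.detect i h y))

/-- The decision region of node `i` for the value `u`. -/
def region (D : NodeDetectors S ρ) (i : Fin N) (h : ℂ) (u : GF B) : Set ℂ :=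
  {y | D.output i h y = u}

/-- `Pr(u_i = u | s_m, h_i = h)`. -/
def transProb (D : NodeDetectors S ρ) (i : Fin N) (u : GF B) (m : Fin M) (h : ℂ) : ℝ :=
  (1 / Real.pi) * ∫ y in D.region i h u, Real.exp (-‖y - h * S.symbol ρ m‖ ^ 2)

end NodeDetectors

/-- Maximum likelihood decoding with full channel knowledge, from the values of all `N` nodes.
Ties are broken in any measurable way. -/
structure MLDecoder {N M K B : ℕ} {S : System N M K B} {ρ : ℝ} (D : NodeDetectors S ρ) where
  decode : (Fin N → ℂ) → (Fin N → GF B) → Fin M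
  measurable_decode : ∀ u, Measurable fun h => decode h u
  decode_max : ∀ h u m,
    ∏ i, D.transProb i (u i) m (h i) ≤ ∏ i, D.transProb i (u i) (decode h u) (h i)

/-- Selected subset maximum likelihood decoding with full channel knowledge: in each of the `L`
groups of nodes `{j, j + L, j + 2L, …}` a node with the strongest channel is selected, and maximum
likelihood decoding is performed from the values of the `L` selected nodes.
Ties are broken in any measurable way. -/
structure SubsetMLDecoder {N M K B : ℕ} {S : System N M K B} {ρ : ℝ} (D : NodeDetectors S ρ)
    (L : ℕ) where
  select : (Fin N → ℂ) → Fin L → Fin N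
  measurable_select : ∀ j, Measurable fun h => select h j
  select_mem : ∀ h j, (select h j : ℕ) % L = j
  select_max : ∀ (h : Fin N → ℂ) (j : Fin L) (k : Fin N), (k : ℕ) % L = j → ‖h k‖ ^ 2 ≤ ‖h (select h j)‖ ^ 2
  decode : (Fin N → ℂ) → (Fin L → GF B) → Fin M
  measurable_decode : ∀ v, Measurable fun h => decode h v
  decode_max : ∀ h v m,
    ∏ j, D.transProb (select h j) (v j) m (h (select h j)) ≤
      ∏ j, D.transProb (select h j) (v j) (decode h v) (h (select h j))

/-- A realization of the transmitted symbol index, the channels, and the noises. -/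
abbrev Sample (N M : ℕ) : Type := Fin M × (Fin N → ℂ) × (Fin N → ℂ)

/-- The joint law: the symbol is uniform, the channels and the noises are `CN(0,1)`, and all of
these variables are independent. -/
def law (N M : ℕ) : Measure (Sample N M) :=
  (ProbabilityTheory.uniformOn (Set.univ : Set (Fin M))).prod
    ((Measure.pi fun _ : Fin N => complexGaussian).prod
      (Measure.pi fun _ : Fin N => complexGaussian))

/-- The value `u_i` sent by node `i`, which observes `y_i = h_i s + n_i`. -/
def NodeDetectors.sent {N M K B : ℕ} {S : System N M K B} {ρ : ℝ} (D : NodeDetectors S ρ)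
    (ω : Sample N M) (i : Fin N) : GF B :=
  D.output i (ω.2.1 i) (ω.2.1 i * S.symbol ρ ω.1 + ω.2.2 i)

/-- Symbol error probability of maximum likelihood decoding. -/
def MLDecoder.errorProb {N M K B : ℕ} {S : System N M K B} {ρ : ℝ} {D : NodeDetectors S ρ}
    (R : MLDecoder D) : ℝ :=
  (law N M).real {ω | R.decode ω.2.1 (D.sent ω) ≠ ω.1}

/-- Symbol error probability of selected subset maximum likelihood decoding. -/
def SubsetMLDecoder.errorProb {N M K B L : ℕ} {S : System N M K B} {ρ : ℝ}
    {D : NodeDetectors S ρ} (R : SubsetMLDecoder D L) : ℝ :=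
  (law N M).real
    {ω | R.decode ω.2.1 (fun j => D.sent ω (R.select ω.2.1 j)) ≠ ω.1}

/-- The error probability `Pe`, a function of the signal-to-noise ratio, has diversity order `d`:
it is positive at high signal-to-noise ratio and `- lim log (Pe ρ) / log ρ = d`. -/
def HasDiversityOrder (Pe : ℝ → ℝ) (d : ℝ) : Prop :=
  (∀ᶠ ρ in atTop, 0 < Pe ρ) ∧
    Tendsto (fun ρ => -(Real.log (Pe ρ) / Real.log ρ)) atTop (𝓝 d)

end

end CodedDiversity

/-!
Both decoders perform maximum likelihood decoding from a set `T` of nodes, possibly depending on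
the channels, which *dominates* all the nodes: every node `k` has a companion `i ∈ T` with the same
processing rule and `|h_k| ≤ |h_i|` (`System.Dominates`).  For full decoding `T` consists of all
nodes, for selected subset decoding of the strongest node of each group.  The diversity order is
computed once, for every such decoder (`hasDiversityOrder_of_dominates`), by bounding the error
probability above and below by constant multiples of `ρ ^ (-d_min)`.

*Upper bound.*  Given the channels, the union--Bhattacharyya bound
(`sum_ne_prod_le_bhattacharyya`) estimates the error probability by a sum over wrong symbols `m'` of
products of the coefficients `∑ u, √(Pr(u | m) Pr(u | m'))` of the nodes of `T`.  These are at most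
`1`, and if the codewords of `m` and `m'` differ at node `i`, then every value `u` is a decision
error for `m` or for `m'`, which makes the coefficient `O(exp (-c ρ |h_i|²))`.  By domination, the
sum of `|h_i|²` over the differing nodes of `T` is at least `1 / N` times the sum over all differing
nodes.  Averaging over the independent channels, `E exp (-a |h|²) = 1 / (1 + a)` yields a factor
`O(1 / ρ)` for each of the at least `d_min` differing nodes (`NodeDetectors.error_le`).

*Lower bound.*  Take `m ≠ m'` at minimum distance.  With probability of order `ρ ^ (-d_min)` the
differing nodes have `|h_i|² ρ` between `1 / 4` and `1`, while the others have `|h_i| ≥ 1`.  The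
codeword of `m` is then received with a probability bounded below whether `m` or `m'` is sent, and
the decision for this received word is wrong for one of the two (`NodeDetectors.le_error`).

The argument includes `d_min = 0`, where the error probability stays bounded below.  The identity
`d_min(C) = (N / L) d_min(C_L)` holds because a codeword of `C` is a codeword of `C_L` repeated
`N / L` times.
-/

namespace CodedDiversity

/-! ### The complex Gaussian law -/

theorem measurable_gaussianDensity :
    Measurable fun z : ℂ => ENNReal.ofReal (Real.exp (-‖z‖ ^ 2) / Real.pi) := by
  fun_prop

theorem integral_exp_neg_mul_norm_sq {b : ℝ} (hb : 0 < b) :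
    ∫ z : ℂ, Real.exp (-b * ‖z‖ ^ 2) = Real.pi / b := by
  rw [GaussianFourier.integral_rexp_neg_mul_sq_norm hb, Complex.finrank_real_complex]
  norm_num

theorem integrable_exp_neg_mul_norm_sq {b : ℝ} (hb : 0 < b) :
    Integrable fun z : ℂ => Real.exp (-b * ‖z‖ ^ 2) := by
  refine Integrable.of_integral_ne_zero ?_
  rw [integral_exp_neg_mul_norm_sq hb]
  positivity

/-- The Laplace transform of the exponential variable `‖z‖ ^ 2`. -/
theorem lintegral_exp_complexGaussian {c : ℝ} (hc : -1 < c) :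
    ∫⁻ z, ENNReal.ofReal (Real.exp (-c * ‖z‖ ^ 2)) ∂complexGaussian =
      ENNReal.ofReal (1 / (1 + c)) := by
  have hb : 0 < 1 + c := by linarith
  rw [complexGaussian, lintegral_withDensity_eq_lintegral_mul _ measurable_gaussianDensity
    (by fun_prop)]
  have h : ∀ z : ℂ, ((fun z : ℂ => ENNReal.ofReal (Real.exp (-‖z‖ ^ 2) / Real.pi)) *
      fun z : ℂ => ENNReal.ofReal (Real.exp (-c * ‖z‖ ^ 2))) z =
      ENNReal.ofReal (Real.exp (-(1 + c) * ‖z‖ ^ 2) / Real.pi) := by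
    intro z
    rw [Pi.mul_apply, ← ENNReal.ofReal_mul (by positivity), div_mul_eq_mul_div, ← Real.exp_add]
    congr 3
    ring
  simp_rw [h]
  rw [← ofReal_integral_eq_lintegral_ofReal ((integrable_exp_neg_mul_norm_sq hb).div_const _)
    (ae_of_all _ fun z => by positivity), integral_div, integral_exp_neg_mul_norm_sq hb]
  congr 1
  field_simp

instance isProbabilityMeasure_complexGaussian : IsProbabilityMeasure complexGaussian :=
  ⟨by simpa using lintegral_exp_complexGaussian (c := 0) (by norm_num)⟩

theorem integral_exp_complexGaussian {c : ℝ} (hc : 0 ≤ c) :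
    ∫ z, Real.exp (-c * ‖z‖ ^ 2) ∂complexGaussian = 1 / (1 + c) := by
  rw [integral_eq_lintegral_of_nonneg_ae (ae_of_all _ fun z => by positivity)
    (by fun_prop), lintegral_exp_complexGaussian (by linarith),
    ENNReal.toReal_ofReal (by positivity)]

/-- A Chernoff bound for the tail of the noise. -/
theorem complexGaussian_norm_ge_le {r : ℝ} (hr : 0 ≤ r) :
    complexGaussian.real {z | r ≤ ‖z‖} ≤ 2 * Real.exp (-r ^ 2 / 2) := by
  have h := mul_meas_ge_le_lintegral (μ := complexGaussian)
    (f := fun z => ENNReal.ofReal (Real.exp (-(-1 / 2) * ‖z‖ ^ 2))) (by fun_prop)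
    (ENNReal.ofReal (Real.exp (r ^ 2 / 2)))
  rw [lintegral_exp_complexGaussian (by norm_num)] at h
  have hsub : {z : ℂ | r ≤ ‖z‖} ⊆ {z : ℂ | ENNReal.ofReal (Real.exp (r ^ 2 / 2)) ≤
      ENNReal.ofReal (Real.exp (-(-1 / 2) * ‖z‖ ^ 2))} := by
    intro z hz
    refine ENNReal.ofReal_le_ofReal (Real.exp_le_exp.2 ?_)
    have : r ^ 2 ≤ ‖z‖ ^ 2 := pow_le_pow_left₀ hr hz 2
    linarith
  have h' : ENNReal.ofReal (Real.exp (r ^ 2 / 2) * complexGaussian.real {z | r ≤ ‖z‖}) ≤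
      ENNReal.ofReal (1 / (1 + -1 / 2)) := by
    rw [ENNReal.ofReal_mul (by positivity), ofReal_measureReal]
    exact (mul_le_mul_right (measure_mono hsub) _).trans h
  rw [ENNReal.ofReal_le_ofReal_iff (by norm_num)] at h'
  rw [neg_div, Real.exp_neg, ← div_eq_mul_inv, le_div_iff₀ (Real.exp_pos _)]
  norm_num at h'
  linarith

/-- The area of the ball times the least value of the density on it. -/
theorem le_complexGaussian_ball (a : ℂ) {r : ℝ} (hr : 0 ≤ r) :
    r ^ 2 * Real.exp (-(‖a‖ + r) ^ 2) ≤ complexGaussian.real (Metric.ball a r) := by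
  rw [measureReal_def, ← ENNReal.ofReal_le_iff_le_toReal (measure_ne_top _ _), complexGaussian,
    withDensity_apply _ measurableSet_ball]
  calc ENNReal.ofReal (r ^ 2 * Real.exp (-(‖a‖ + r) ^ 2))
      = ∫⁻ _ in Metric.ball a r, ENNReal.ofReal (Real.exp (-(‖a‖ + r) ^ 2) / Real.pi) := by
        have hpi : (NNReal.pi : ENNReal) = ENNReal.ofReal Real.pi := by
          rw [ENNReal.ofReal, ← NNReal.coe_real_pi, Real.toNNReal_coe]
        rw [setLIntegral_const, Complex.volume_ball, hpi, ← ENNReal.ofReal_pow hr,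
          ← ENNReal.ofReal_mul (by positivity), ← ENNReal.ofReal_mul (by positivity)]
        congr 1
        field_simp
    _ ≤ _ := by
        refine setLIntegral_mono measurable_gaussianDensity fun z hz => ?_
        refine ENNReal.ofReal_le_ofReal ?_
        have h1 : ‖z‖ ≤ ‖a‖ + r := by
          have := norm_sub_norm_le z a
          have h2 := mem_ball_iff_norm.1 hz
          linarith
        gcongr

/-- A change of variables: the Gaussian law of the noise, seen at the observation `b + n`. -/
theorem integral_gaussian_region_eq {A : Set ℂ} (hA : MeasurableSet A) (b : ℂ) :
    (1 / Real.pi) * ∫ y in A, Real.exp (-‖y - b‖ ^ 2) =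
      complexGaussian.real {n | b + n ∈ A} := by
  have hA' : MeasurableSet {n | b + n ∈ A} := (measurable_const_add b) hA
  have hint : Integrable fun z : ℂ => Real.exp (-‖z‖ ^ 2) / Real.pi := by
    simpa using (integrable_exp_neg_mul_norm_sq one_pos).div_const Real.pi
  have h1 : complexGaussian.real {n | b + n ∈ A} =
      ∫ n in {n | b + n ∈ A}, Real.exp (-‖n‖ ^ 2) / Real.pi := by
    rw [measureReal_def, complexGaussian, withDensity_apply _ hA',
      integral_eq_lintegral_of_nonneg_ae (ae_of_all _ fun z => by positivity)
      hint.aestronglyMeasurable.restrict]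
  rw [h1, ← integral_indicator hA', ← integral_indicator hA, ← integral_const_mul,
    ← integral_add_left_eq_self _ b]
  congr 1
  ext n
  by_cases h : b + n ∈ A
  · simp [Set.indicator, h, div_eq_inv_mul]
  · simp [Set.indicator, h]

/-! ### A union--Bhattacharyya bound -/

/-- The union--Bhattacharyya bound, when the decoder `g` maximizes the likelihood of the letters
in a subset `T` of the positions only.  The other letters are summed out. -/
theorem sum_ne_prod_le_bhattacharyya {ι α κ : Type*} [Fintype ι] [DecidableEq ι] [Fintype α]
    [Fintype κ] [DecidableEq κ]
    {p : κ → ι → α → ℝ} (hp : ∀ m i u, 0 ≤ p m i u) {T : Finset ι} {g : (ι → α) → κ}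
    (m : κ) (hg : ∀ w, ∏ i ∈ T, p m i (w i) ≤ ∏ i ∈ T, p (g w) i (w i)) :
    ∑ w with g w ≠ m, ∏ i, p m i (w i) ≤
      ∑ m' ∈ Finset.univ.erase m, ∏ i, ∑ u,
        if i ∈ T then √(p m i u * p m' i u) else p m i u := by
  obtain ⟨q, hq⟩ : ∃ q : κ → ι → α → ℝ, ∀ m' i u,
      q m' i u = if i ∈ T then √(p m i u * p m' i u) else p m i u := ⟨_, fun _ _ _ => rfl⟩
  simp_rw [← hq]
  have hq0 : ∀ m' i u, 0 ≤ q m' i u := by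
    intro m' i u
    rw [hq]
    split_ifs
    · positivity
    · exact hp _ _ _
  have key : ∀ w, ∏ i, p m i (w i) ≤ ∏ i, q (g w) i (w i) := by
    intro w
    rw [← Finset.prod_mul_prod_compl T, ← Finset.prod_mul_prod_compl T
      (fun i => q (g w) i (w i))]
    have h1 : ∏ i ∈ Tᶜ, q (g w) i (w i) = ∏ i ∈ Tᶜ, p m i (w i) :=
      Finset.prod_congr rfl fun i hi => (hq _ _ _).trans (if_neg (Finset.mem_compl.1 hi))
    have h2 : ∏ i ∈ T, q (g w) i (w i) =
        √((∏ i ∈ T, p m i (w i)) * ∏ i ∈ T, p (g w) i (w i)) := by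
      rw [← Finset.prod_mul_distrib, Real.sqrt_prod _ fun i _ => mul_nonneg (hp _ _ _) (hp _ _ _)]
      exact Finset.prod_congr rfl fun i hi => (hq _ _ _).trans (if_pos hi)
    rw [h1, h2]
    refine mul_le_mul_of_nonneg_right ?_ (Finset.prod_nonneg fun i _ => hp _ _ _)
    have h0 : 0 ≤ ∏ i ∈ T, p m i (w i) := Finset.prod_nonneg fun i _ => hp _ _ _
    refine Real.le_sqrt_of_sq_le ?_
    rw [sq]
    exact mul_le_mul_of_nonneg_left (hg w) h0
  have hprod : ∀ (w : ι → α) m', 0 ≤ ∏ i, q m' i (w i) := fun w m' =>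
    Finset.prod_nonneg fun i _ => hq0 _ _ _
  calc ∑ w : ι → α with g w ≠ m, ∏ i, p m i (w i)
      ≤ ∑ w : ι → α with g w ≠ m, ∑ m' ∈ Finset.univ.erase m, ∏ i, q m' i (w i) := by
        refine Finset.sum_le_sum fun w hw => (key w).trans ?_
        exact Finset.single_le_sum (f := fun m' => ∏ i, q m' i (w i)) (fun m' _ => hprod w m')
          (Finset.mem_erase.2 ⟨(Finset.mem_filter.1 hw).2, Finset.mem_univ _⟩)
    _ ≤ ∑ w : ι → α, ∑ m' ∈ Finset.univ.erase m, ∏ i, q m' i (w i) :=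
        Finset.sum_le_sum_of_subset_of_nonneg (Finset.subset_univ _) fun w _ _ =>
          Finset.sum_nonneg fun m' _ => hprod w m'
    _ = ∑ m' ∈ Finset.univ.erase m, ∏ i, ∑ u, q m' i u := by
        rw [Finset.sum_comm]
        refine Finset.sum_congr rfl fun m' _ => ?_
        rw [Finset.prod_univ_sum, Fintype.piFinset_univ]

/-! ### Transition probabilities of a node -/

noncomputable instance instFintypeGF (B : ℕ) : Fintype (GF B) := Fintype.ofFinite _

/-- A common lower bound `δ` for the distances between distinct normalized constellation points. -/
def System.Separated {N M K B : ℕ} (S : System N M K B) (δ : ℝ) : Prop :=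
  ∀ m m', m ≠ m' → δ ≤ ‖S.point m - S.point m'‖

theorem System.exists_separated {N M K B : ℕ} (S : System N M K B) :
    ∃ δ, 0 < δ ∧ S.Separated δ := by
  have hfin : {d | ∃ m m', m ≠ m' ∧ d = ‖S.point m - S.point m'‖}.Finite := by
    refine (Set.finite_range fun p : Fin M × Fin M => ‖S.point p.1 - S.point p.2‖).subset ?_
    rintro _ ⟨m, m', -, rfl⟩
    exact ⟨(m, m'), rfl⟩
  rcases Set.eq_empty_or_nonempty {d | ∃ m m', m ≠ m' ∧ d = ‖S.point m - S.point m'‖} with h | h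
  · refine ⟨1, one_pos, fun m m' hne => ?_⟩
    exact absurd (show ‖S.point m - S.point m'‖ ∈ (∅ : Set ℝ) from h ▸ ⟨m, m', hne, rfl⟩)
      (Set.notMem_empty _)
  · obtain ⟨δ, ⟨m, m', hne, rfl⟩, hmin⟩ := Set.exists_min_image _ id hfin h
    refine ⟨_, norm_pos_iff.2 (sub_ne_zero.2 fun h => hne (S.point_injective h)), ?_⟩
    exact fun k k' hk => hmin _ ⟨k, k', hk, rfl⟩

theorem System.rule_label {N M K B : ℕ} (S : System N M K B) (i : Fin N) (m : Fin M) :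
    S.rule i (S.label m) = codeword S.label S.gen m i := rfl

theorem System.norm_symbol_sub {N M K B : ℕ} (S : System N M K B) (ρ : ℝ) (m m' : Fin M) :
    ‖S.symbol ρ m - S.symbol ρ m'‖ = √ρ * ‖S.point m - S.point m'‖ := by
  rw [System.symbol, System.symbol, ← mul_sub, norm_mul, Complex.norm_real, Real.norm_eq_abs,
    abs_of_nonneg (Real.sqrt_nonneg _)]

variable {N M K B : ℕ} {S : System N M K B} {ρ : ℝ}

namespace NodeDetectors

variable (D : NodeDetectors S ρ)

theorem measurableSet_output_eq (i : Fin N) (u : GF B) :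
    MeasurableSet {p : ℂ × ℂ | D.output i p.1 p.2 = u} :=
  (D.measurable_detect i) (MeasurableSet.of_discrete (s := {m | S.rule i (S.label m) = u}))

theorem measurableSet_region (i : Fin N) (h : ℂ) (u : GF B) : MeasurableSet (D.region i h u) :=
  measurable_prodMk_left (D.measurableSet_output_eq i u)

theorem transProb_eq (i : Fin N) (u : GF B) (m : Fin M) (h : ℂ) :
    D.transProb i u m h =
      complexGaussian.real {n | D.output i h (h * S.symbol ρ m + n) = u} :=
  integral_gaussian_region_eq (D.measurableSet_region i h u) _

theorem transProb_nonneg (i : Fin N) (u : GF B) (m : Fin M) (h : ℂ) :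
    0 ≤ D.transProb i u m h := by
  rw [transProb_eq]
  exact measureReal_nonneg

theorem transProb_le_one (i : Fin N) (u : GF B) (m : Fin M) (h : ℂ) :
    D.transProb i u m h ≤ 1 := by
  rw [transProb_eq]
  exact measureReal_le_one

theorem sum_transProb (i : Fin N) (m : Fin M) (h : ℂ) : ∑ u, D.transProb i u m h = 1 := by
  simp_rw [transProb_eq]
  have hm : ∀ u, MeasurableSet {n | D.output i h (h * S.symbol ρ m + n) = u} := fun u =>
    (measurable_const_add _) (D.measurableSet_region i h u)
  rw [← measureReal_biUnion_finset (fun u _ v _ huv => Set.disjoint_left.2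
    fun n hu hv => huv (hu.symm.trans hv)) fun u _ => hm u]
  have : (⋃ u ∈ (Finset.univ : Finset (GF B)), {n | D.output i h (h * S.symbol ρ m + n) = u}) =
      Set.univ := by
    ext n
    simp
  rw [this, probReal_univ]

/-- A node decides correctly when the noise is below half the distance of the received points. -/
theorem detect_eq_of_norm_lt {δ : ℝ} (hδ : S.Separated δ) {i : Fin N} {h y : ℂ} {m : Fin M}
    (hy : ‖y - h * S.symbol ρ m‖ < ‖h‖ * √ρ * δ / 2) : D.detect i h y = m := by
  by_contra hne
  have h1 := D.detect_min i h y m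
  have h2 : ‖h‖ * √ρ * δ ≤
      ‖h * S.symbol ρ (D.detect i h y) - h * S.symbol ρ m‖ := by
    rw [← mul_sub, norm_mul, S.norm_symbol_sub, mul_assoc]
    have := hδ _ _ hne
    gcongr
  have h3 := norm_sub_le_norm_sub_add_norm_sub
    (h * S.symbol ρ (D.detect i h y)) y (h * S.symbol ρ m)
  rw [norm_sub_rev _ y] at h3
  linarith

theorem transProb_le_of_ne {δ : ℝ} (hδ0 : 0 ≤ δ) (hρ : 0 ≤ ρ) (hδ : S.Separated δ) {i : Fin N}
    {u : GF B} {m : Fin M} (hu : codeword S.label S.gen m i ≠ u) (h : ℂ) :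
    D.transProb i u m h ≤ 2 * Real.exp (-(δ ^ 2 / 8 * ρ * ‖h‖ ^ 2)) := by
  rw [transProb_eq]
  have hsub : {n | D.output i h (h * S.symbol ρ m + n) = u} ⊆ {n | ‖h‖ * √ρ * δ / 2 ≤ ‖n‖} := by
    intro n hn
    by_contra hlt
    refine hu ?_
    rw [Set.mem_ofPred_eq, not_le] at hlt
    have hd : D.detect i h (h * S.symbol ρ m + n) = m :=
      D.detect_eq_of_norm_lt hδ (by simpa using hlt)
    rw [← S.rule_label, ← hn, output, hd]
  refine (measureReal_mono hsub).trans ((complexGaussian_norm_ge_le (by positivity)).trans_eq ?_)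
  congr 2
  have : √ρ ^ 2 = ρ := Real.sq_sqrt hρ
  calc -(‖h‖ * √ρ * δ / 2) ^ 2 / 2 = -(δ ^ 2 / 8 * √ρ ^ 2 * ‖h‖ ^ 2) := by ring
    _ = _ := by rw [this]

theorem sum_sqrt_transProb_le_one (i : Fin N) (m m' : Fin M) (h : ℂ) :
    ∑ u, √(D.transProb i u m h * D.transProb i u m' h) ≤ 1 := by
  have := Real.sum_sqrt_mul_sqrt_le Finset.univ
    (fun u => D.transProb_nonneg i u m h) (fun u => D.transProb_nonneg i u m' h)
  simp_rw [D.sum_transProb, Real.sqrt_one, mul_one] at this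
  refine le_trans (le_of_eq ?_) this
  exact Finset.sum_congr rfl fun u _ => Real.sqrt_mul (D.transProb_nonneg i u m h) _

/-- The Bhattacharyya coefficient of a node that separates `m` from `m'`: each value `u` is a
decision error for one of the two symbols. -/
theorem sum_sqrt_transProb_le {δ : ℝ} (hδ0 : 0 ≤ δ) (hρ : 0 ≤ ρ) (hδ : S.Separated δ) {i : Fin N}
    {m m' : Fin M} (hne : codeword S.label S.gen m i ≠ codeword S.label S.gen m' i) (h : ℂ) :
    ∑ u, √(D.transProb i u m h * D.transProb i u m' h) ≤
      2 * Fintype.card (GF B) * Real.exp (-(δ ^ 2 / 16 * ρ * ‖h‖ ^ 2)) := by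
  have key : ∀ u, √(D.transProb i u m h * D.transProb i u m' h) ≤
      2 * Real.exp (-(δ ^ 2 / 16 * ρ * ‖h‖ ^ 2)) := by
    intro u
    have hle : D.transProb i u m h * D.transProb i u m' h ≤
        2 * Real.exp (-(δ ^ 2 / 8 * ρ * ‖h‖ ^ 2)) := by
      by_cases hu : codeword S.label S.gen m i = u
      · have hu' : codeword S.label S.gen m' i ≠ u := fun h' => hne (hu.trans h'.symm)
        exact (mul_le_of_le_one_left (D.transProb_nonneg _ _ _ _)
          (D.transProb_le_one _ _ _ _)).trans (D.transProb_le_of_ne hδ0 hρ hδ hu' h)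
      · exact (mul_le_of_le_one_right (D.transProb_nonneg _ _ _ _)
          (D.transProb_le_one _ _ _ _)).trans (D.transProb_le_of_ne hδ0 hρ hδ hu h)
    refine Real.sqrt_le_iff.2 ⟨by positivity, hle.trans ?_⟩
    have : Real.exp (-(δ ^ 2 / 8 * ρ * ‖h‖ ^ 2)) =
        Real.exp (-(δ ^ 2 / 16 * ρ * ‖h‖ ^ 2)) ^ 2 := by
      rw [← Real.exp_nat_mul]
      congr 1
      push_cast
      ring
    rw [this, mul_pow]
    gcongr
    norm_num
  refine (Finset.sum_le_sum fun u _ => key u).trans_eq ?_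
  rw [Finset.sum_const, Finset.card_univ, nsmul_eq_mul]
  ring

theorem ball_le_transProb {δ : ℝ} (hδ0 : 0 ≤ δ) (hδ : S.Separated δ) (i : Fin N) (m m' : Fin M)
    {h : ℂ} (hh : 1 / 2 ≤ ‖h‖ * √ρ) :
    complexGaussian.real (Metric.ball (h * (S.symbol ρ m - S.symbol ρ m')) (δ / 4)) ≤
      D.transProb i (codeword S.label S.gen m i) m' h := by
  rw [transProb_eq]
  refine measureReal_mono fun n hn => ?_
  rw [mem_ball_iff_norm] at hn
  rw [Set.mem_ofPred_eq, output, D.detect_eq_of_norm_lt hδ, S.rule_label]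
  have : h * S.symbol ρ m' + n - h * S.symbol ρ m =
      n - h * (S.symbol ρ m - S.symbol ρ m') := by ring
  rw [this]
  refine hn.trans_le ?_
  nlinarith [mul_le_mul_of_nonneg_right hh hδ0]

/-- The value that stands for `m` is received with a probability bounded below if `m'` is sent,
provided that the instantaneous signal-to-noise ratio is low enough to confuse the two symbols.
The case `m = m'` covers correct reception, for which no upper bound on the ratio is needed. -/
theorem le_transProb {δ : ℝ} (hδ0 : 0 ≤ δ) (hδ : S.Separated δ) (i : Fin N) (m m' : Fin M)
    {h : ℂ} (hh : 1 / 2 ≤ ‖h‖ * √ρ) (hh' : ‖h‖ * √ρ ≤ 1 ∨ m = m') :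
    (δ / 4) ^ 2 * Real.exp (-(‖S.point m - S.point m'‖ + δ / 4) ^ 2) ≤
      D.transProb i (codeword S.label S.gen m i) m' h := by
  refine le_trans ?_ ((le_complexGaussian_ball _ (by positivity)).trans
    (D.ball_le_transProb hδ0 hδ i m m' hh))
  have : ‖h * (S.symbol ρ m - S.symbol ρ m')‖ ≤ ‖S.point m - S.point m'‖ := by
    rw [norm_mul, S.norm_symbol_sub, ← mul_assoc]
    rcases hh' with hh' | rfl
    · exact mul_le_of_le_one_left (norm_nonneg _) hh'
    · simp
  gcongr

end NodeDetectors

/-! ### Distinguishing and dominating nodes -/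

open scoped Classical in
/-- The nodes whose values distinguish `m` from `m'`. -/
noncomputable def System.diffNodes (S : System N M K B) (m m' : Fin M) :
    Finset (Fin N) :=
  Finset.univ.filter fun i => codeword S.label S.gen m i ≠ codeword S.label S.gen m' i

theorem System.mem_diffNodes {m m' : Fin M} {i : Fin N} :
    i ∈ S.diffNodes m m' ↔ codeword S.label S.gen m i ≠ codeword S.label S.gen m' i := by
  simp [System.diffNodes]

open scoped Classical in
theorem System.dMin_le_card_diffNodes {m m' : Fin M} (hne : m ≠ m') :
    S.dMin ≤ (S.diffNodes m m').card :=
  Nat.sInf_le ⟨m, m', hne, rfl⟩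

open scoped Classical in
theorem System.exists_card_diffNodes_eq (hM : 2 ≤ M) :
    ∃ m m', m ≠ m' ∧ (S.diffNodes m m').card = S.dMin := by
  obtain ⟨m, m', hne, h⟩ := Nat.sInf_mem (s := {d | ∃ m m' : Fin M, m ≠ m' ∧
    d = hammingDist (codeword S.label S.gen m) (codeword S.label S.gen m')})
    ⟨_, ⟨0, by omega⟩, ⟨1, by omega⟩, by simp, rfl⟩
  exact ⟨m, m', hne, h.symm⟩

/-- The subset `T` of the nodes contains, for each node, one with the same processing rule and a
channel that is at least as strong. -/
def System.Dominates (S : System N M K B) (T : Finset (Fin N))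
    (h : Fin N → ℂ) : Prop :=
  ∀ k, ∃ i ∈ T, S.gen.col k = S.gen.col i ∧ ‖h k‖ ^ 2 ≤ ‖h i‖ ^ 2

/-- Each channel of the sum on the left is at most as strong as a single term on the right, since
the dominating node of a distinguishing node is itself distinguishing. -/
theorem System.Dominates.sum_le {T : Finset (Fin N)} {h : Fin N → ℂ}
    (hT : S.Dominates T h) (m m' : Fin M) :
    ∑ k ∈ S.diffNodes m m', ‖h k‖ ^ 2 ≤ N * ∑ i ∈ T ∩ S.diffNodes m m', ‖h i‖ ^ 2 := by
  have key : ∀ k ∈ S.diffNodes m m', ‖h k‖ ^ 2 ≤ ∑ i ∈ T ∩ S.diffNodes m m', ‖h i‖ ^ 2 := by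
    intro k hk
    obtain ⟨i, hi, hcol, hle⟩ := hT k
    refine hle.trans (Finset.single_le_sum (f := fun i => ‖h i‖ ^ 2) (fun _ _ => by positivity)
      (Finset.mem_inter.2 ⟨hi, System.mem_diffNodes.2 ?_⟩))
    have := System.mem_diffNodes.1 hk
    rw [← S.rule_label, ← S.rule_label, System.rule, System.rule] at this ⊢
    rwa [← hcol]
  refine (Finset.sum_le_card_nsmul _ _ _ key).trans ?_
  rw [nsmul_eq_mul]
  refine mul_le_mul_of_nonneg_right ?_ (Finset.sum_nonneg fun _ _ => by positivity)
  exact_mod_cast (Finset.card_le_univ _).trans_eq (Fintype.card_fin N)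

/-! ### The joint law and the conditional error probability -/

/-- The law `CN(0,1)^N` of the channels, and of the noises. -/
noncomputable abbrev gaussianVector (N : ℕ) : Measure (Fin N → ℂ) :=
  Measure.pi fun _ : Fin N => complexGaussian

/-- The average of an exponential of the energy of a set of channels, each of which contributes
the Laplace transform of an exponential variable. -/
theorem integral_exp_sum_gaussianVector {a : ℝ} (ha : 0 ≤ a)
    (A : Finset (Fin N)) :
    ∫ h, Real.exp (-(a * ∑ k ∈ A, ‖h k‖ ^ 2)) ∂gaussianVector N = (1 / (1 + a)) ^ A.card := by
  classical
  have h1 : ∀ h : Fin N → ℂ, Real.exp (-(a * ∑ k ∈ A, ‖h k‖ ^ 2)) =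
      ∏ k, Real.exp (-(if k ∈ A then a else 0) * ‖h k‖ ^ 2) := by
    intro h
    rw [← Real.exp_sum]
    congr 1
    rw [Finset.mul_sum, ← Finset.sum_neg_distrib, ← Finset.sum_filter_add_sum_filter_not
      Finset.univ (fun k => k ∈ A), Finset.sum_eq_zero (s := Finset.univ.filter fun k => k ∉ A)
      (fun k hk => by simp [(Finset.mem_filter.1 hk).2]), add_zero, Finset.filter_univ_mem]
    exact Finset.sum_congr rfl fun k hk => by simp [hk]
  simp_rw [h1]
  rw [integral_fintype_prod_eq_prod
    (f := fun k (z : ℂ) => Real.exp (-(if k ∈ A then a else 0) * ‖z‖ ^ 2))]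
  have h2 : ∀ k, ∫ z, Real.exp (-(if k ∈ A then a else 0) * ‖z‖ ^ 2) ∂complexGaussian =
      if k ∈ A then 1 / (1 + a) else 1 := by
    intro k
    by_cases hk : k ∈ A
    · simpa [hk] using integral_exp_complexGaussian ha
    · simp [hk]
  simp_rw [h2]
  rw [Finset.prod_ite_mem, Finset.univ_inter, Finset.prod_const]

/-- An average over the symbols and the channels of the conditional probability. -/
theorem law_real_eq {s : Set (Sample N M)} (hs : MeasurableSet s) :
    (law N M).real s = (∑ m : Fin M,
      ∫ h, (gaussianVector N).real {n | (m, h, n) ∈ s} ∂gaussianVector N) / M := by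
  have h1 : ∀ m : Fin M, ((gaussianVector N).prod (gaussianVector N)).real (Prod.mk m ⁻¹' s) =
      ∫ h, (gaussianVector N).real {n | (m, h, n) ∈ s} ∂gaussianVector N := by
    intro m
    have hm : MeasurableSet (Prod.mk m ⁻¹' s) := measurable_prodMk_left hs
    rw [measureReal_def, Measure.prod_apply hm, ← integral_toReal
      (measurable_measure_prodMk_left hm).aemeasurable (ae_of_all _ fun _ => measure_lt_top _ _)]
    rfl
  have h2 : ∀ m : Fin M, ProbabilityTheory.uniformOn (Set.univ : Set (Fin M)) {m} =
      (M : ENNReal)⁻¹ := by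
    intro m
    rw [ProbabilityTheory.uniformOn_univ, Measure.count_singleton, Fintype.card_fin, one_div]
  rw [measureReal_def, law, Measure.prod_apply hs, lintegral_fintype, ENNReal.toReal_sum
    fun m _ => ENNReal.mul_ne_top (measure_ne_top _ _) (by rw [h2]; simp [(Fin.pos m).ne']),
    Finset.sum_div]
  refine Finset.sum_congr rfl fun m _ => ?_
  rw [ENNReal.toReal_mul, h2, ENNReal.toReal_inv, ENNReal.toReal_natCast, ← h1, ← div_eq_mul_inv]
  rfl

namespace NodeDetectors

variable (D : NodeDetectors S ρ)

theorem measurableSet_sent_eq (w : Fin N → GF B) :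
    MeasurableSet {ω : Sample N M | D.sent ω = w} := by
  have h : {ω : Sample N M | D.sent ω = w} = ⋂ i, {ω | D.sent ω i = w i} := by
    ext ω
    simp [funext_iff]
  rw [h]
  refine MeasurableSet.iInter fun i => ?_
  have hsym : Measurable (S.symbol ρ) := measurable_of_finite _
  have hf : Measurable fun ω : Sample N M =>
      (ω.2.1 i, ω.2.1 i * S.symbol ρ ω.1 + ω.2.2 i) := by fun_prop
  exact hf (D.measurableSet_output_eq i (w i))

theorem measurableSet_error {g : (Fin N → ℂ) → (Fin N → GF B) → Fin M}
    (hg : ∀ w, Measurable fun h => g h w) :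
    MeasurableSet {ω : Sample N M | g ω.2.1 (D.sent ω) ≠ ω.1} := by
  have h : {ω : Sample N M | g ω.2.1 (D.sent ω) ≠ ω.1} =
      ⋃ w, {ω | D.sent ω = w} ∩ {ω | g ω.2.1 w = ω.1}ᶜ := by
    ext ω
    simp
  rw [h]
  refine MeasurableSet.iUnion fun w => (D.measurableSet_sent_eq w).inter
    (MeasurableSet.compl (measurableSet_eq_fun ?_ measurable_fst))
  exact (hg w).comp (measurable_fst.comp measurable_snd)

/-- Given the symbol and the channels, the values sent by the nodes are independent. -/
theorem gaussianVector_sent_eq (m : Fin M) (h : Fin N → ℂ) (w : Fin N → GF B) :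
    (gaussianVector N).real {n | D.sent (m, h, n) = w} =
      ∏ i, D.transProb i (w i) m (h i) := by
  have hs : {n | D.sent (m, h, n) = w} = Set.pi Set.univ fun i =>
      {n | D.output i (h i) (h i * S.symbol ρ m + n) = w i} := by
    ext n
    simp [funext_iff, sent]
  rw [hs, measureReal_def, Measure.pi_pi, ENNReal.toReal_prod]
  simp_rw [D.transProb_eq]
  rfl

/-! ### Upper bound on the error probability -/

/-- Maximum likelihood decoding from a dominating set of nodes, for given channels: the energies of
all the distinguishing nodes enter the exponent, at the price of a factor `1 / N`. -/
theorem conditional_error_le {δ : ℝ} (hδ0 : 0 ≤ δ) (hρ : 0 ≤ ρ) (hδ : S.Separated δ)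
    {T : Finset (Fin N)} {h : Fin N → ℂ} (hT : S.Dominates T h) {g : (Fin N → GF B) → Fin M}
    (m : Fin M) (hg : ∀ w, ∏ i ∈ T, D.transProb i (w i) m (h i) ≤
      ∏ i ∈ T, D.transProb i (w i) (g w) (h i)) :
    (gaussianVector N).real {n | g (D.sent (m, h, n)) ≠ m} ≤
      ∑ m' ∈ Finset.univ.erase m, (2 * Fintype.card (GF B) : ℝ) ^ N *
        Real.exp (-(δ ^ 2 / 16 * ρ / N * ∑ k ∈ S.diffNodes m m', ‖h k‖ ^ 2)) := by
  have hC : (1 : ℝ) ≤ 2 * Fintype.card (GF B) := by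
    have : (1 : ℝ) ≤ Fintype.card (GF B) := by exact_mod_cast Fintype.card_pos
    linarith
  have hset : {n | g (D.sent (m, h, n)) ≠ m} =
      ⋃ w ∈ Finset.univ.filter (fun w => g w ≠ m), {n | D.sent (m, h, n) = w} := by
    ext n
    simp
  rw [hset]
  refine (measureReal_biUnion_finset_le _ _).trans ?_
  simp_rw [D.gaussianVector_sent_eq]
  refine (sum_ne_prod_le_bhattacharyya (p := fun m i u => D.transProb i u m (h i))
    (fun m i u => D.transProb_nonneg i u m (h i)) m hg).trans ?_
  refine Finset.sum_le_sum fun m' _ => ?_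
  set q : Fin N → ℝ := fun i => ∑ u, if i ∈ T then
    √(D.transProb i u m (h i) * D.transProb i u m' (h i)) else D.transProb i u m (h i) with hqdef
  have hq0 : ∀ i, 0 ≤ q i := fun i => Finset.sum_nonneg fun u _ => by
    split_ifs
    · positivity
    · exact D.transProb_nonneg _ _ _ _
  have hq1 : ∀ i, q i ≤ 1 := by
    intro i
    by_cases hi : i ∈ T
    · simpa [hqdef, hi] using D.sum_sqrt_transProb_le_one i m m' (h i)
    · simpa [hqdef, hi] using (D.sum_transProb i m (h i)).le
  have hq2 : ∀ i ∈ T ∩ S.diffNodes m m',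
      q i ≤ 2 * Fintype.card (GF B) * Real.exp (-(δ ^ 2 / 16 * ρ * ‖h i‖ ^ 2)) := by
    intro i hi
    obtain ⟨hi1, hi2⟩ := Finset.mem_inter.1 hi
    simpa [hqdef, hi1] using
      D.sum_sqrt_transProb_le hδ0 hρ hδ (System.mem_diffNodes.1 hi2) (h i)
  calc ∏ i, q i ≤ ∏ i ∈ T ∩ S.diffNodes m m', q i :=
        Finset.prod_le_prod_of_subset_of_le_one (Finset.subset_univ _) (fun i _ => hq0 i)
          fun i _ _ => hq1 i
    _ ≤ ∏ i ∈ T ∩ S.diffNodes m m',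
          (2 * Fintype.card (GF B) * Real.exp (-(δ ^ 2 / 16 * ρ * ‖h i‖ ^ 2))) :=
        Finset.prod_le_prod (fun i _ => hq0 i) hq2
    _ = (2 * Fintype.card (GF B) : ℝ) ^ (T ∩ S.diffNodes m m').card *
          Real.exp (-(δ ^ 2 / 16 * ρ * ∑ i ∈ T ∩ S.diffNodes m m', ‖h i‖ ^ 2)) := by
        rw [Finset.prod_mul_distrib, Finset.prod_const, ← Real.exp_sum, Finset.sum_neg_distrib,
          Finset.mul_sum]
    _ ≤ _ := by
        have hcard : (T ∩ S.diffNodes m m').card ≤ N :=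
          (Finset.card_le_univ _).trans_eq (Fintype.card_fin N)
        refine mul_le_mul (pow_le_pow_right₀ hC hcard) (Real.exp_le_exp.2 (neg_le_neg ?_))
          (Real.exp_pos _).le (by positivity)
        rw [div_mul_eq_mul_div]
        refine div_le_of_le_mul₀ (Nat.cast_nonneg N) (by positivity) ?_
        rw [mul_assoc]
        rw [mul_assoc (δ ^ 2 / 16 * ρ), mul_comm _ (N : ℝ), ← mul_assoc]
        exact mul_le_mul_of_nonneg_left (hT.sum_le m m') (by positivity)

theorem error_le {δ : ℝ} (hδ0 : 0 ≤ δ) (hρ : 0 ≤ ρ) (hδ : S.Separated δ)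
    {g : (Fin N → ℂ) → (Fin N → GF B) → Fin M} (hgm : ∀ w, Measurable fun h => g h w)
    (hg : ∀ h, ∃ T, S.Dominates T h ∧ ∀ w m, ∏ i ∈ T, D.transProb i (w i) m (h i) ≤
      ∏ i ∈ T, D.transProb i (w i) (g h w) (h i)) :
    (law N M).real {ω | g ω.2.1 (D.sent ω) ≠ ω.1} ≤
      M * (2 * Fintype.card (GF B)) ^ N * (1 / (1 + δ ^ 2 / 16 * ρ / N)) ^ S.dMin := by
  classical
  rw [law_real_eq (D.measurableSet_error hgm)]
  set a : ℝ := δ ^ 2 / 16 * ρ / N with ha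
  have ha0 : 0 ≤ a := by positivity
  have hint : ∀ A : Finset (Fin N),
      Integrable (fun h => Real.exp (-(a * ∑ k ∈ A, ‖h k‖ ^ 2))) (gaussianVector N) := by
    intro A
    refine Integrable.of_integral_ne_zero ?_
    rw [integral_exp_sum_gaussianVector ha0]
    positivity
  have key : ∀ m, ∫ h, (gaussianVector N).real
      {n | (m, h, n) ∈ {ω : Sample N M | g ω.2.1 (D.sent ω) ≠ ω.1}} ∂gaussianVector N ≤
      M * (2 * Fintype.card (GF B)) ^ N * (1 / (1 + a)) ^ S.dMin := by
    intro m
    calc _ ≤ ∫ h, ∑ m' ∈ Finset.univ.erase m, (2 * Fintype.card (GF B) : ℝ) ^ N *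
          Real.exp (-(a * ∑ k ∈ S.diffNodes m m', ‖h k‖ ^ 2)) ∂gaussianVector N := by
          refine integral_mono_of_nonneg (ae_of_all _ fun h => measureReal_nonneg)
            (integrable_finsetSum _ fun m' _ => (hint _).const_mul _) (ae_of_all _ fun h => ?_)
          obtain ⟨T, hT, hmax⟩ := hg h
          exact D.conditional_error_le hδ0 hρ hδ hT m fun w => hmax w m
      _ = ∑ m' ∈ Finset.univ.erase m, (2 * Fintype.card (GF B) : ℝ) ^ N *
          (1 / (1 + a)) ^ (S.diffNodes m m').card := by
          rw [integral_finsetSum _ fun m' _ => (hint _).const_mul _]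
          simp_rw [integral_const_mul, integral_exp_sum_gaussianVector ha0]
      _ ≤ ∑ m' ∈ Finset.univ.erase m, (2 * Fintype.card (GF B) : ℝ) ^ N *
          (1 / (1 + a)) ^ S.dMin := by
          refine Finset.sum_le_sum fun m' hm' => mul_le_mul_of_nonneg_left ?_ (by positivity)
          exact pow_le_pow_of_le_one (by positivity) (div_le_one_of_le₀ (by linarith)
            (by positivity)) (System.dMin_le_card_diffNodes (Finset.ne_of_mem_erase hm').symm)
      _ ≤ _ := by
          rw [Finset.sum_const, nsmul_eq_mul, mul_assoc]
          refine mul_le_mul_of_nonneg_right ?_ (by positivity)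
          exact_mod_cast (Finset.card_le_univ _).trans_eq (Fintype.card_fin M)
  refine div_le_of_le_mul₀ (Nat.cast_nonneg _) (by positivity) ?_
  refine (Finset.sum_le_sum fun m _ => key m).trans_eq ?_
  rw [Finset.sum_const, Finset.card_univ, Fintype.card_fin, nsmul_eq_mul, mul_comm]

end NodeDetectors

/-! ### Lower bound on the error probability -/

/-- A disc in the annulus `1 / 2 ≤ ‖h‖ * √ρ ≤ 1`. -/
noncomputable def weakChannels (ρ : ℝ) : Set ℂ :=
  Metric.ball ((3 / 4 / √ρ : ℝ) : ℂ) (1 / 4 / √ρ)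

theorem norm_mem_Icc_of_mem_ball {a r : ℝ} (ha : 0 ≤ a) {z : ℂ} (hz : z ∈ Metric.ball (a : ℂ) r) :
    ‖z‖ ∈ Set.Icc (a - r) (a + r) := by
  have h1 := mem_ball_iff_norm.1 hz
  have h2 := abs_norm_sub_norm_le z (a : ℂ)
  rw [Complex.norm_real, Real.norm_eq_abs, abs_of_nonneg ha] at h2
  have := abs_le.1 h2
  constructor <;> linarith

theorem norm_mul_sqrt_mem_Icc (hρ : 0 < ρ) {h : ℂ} (hh : h ∈ weakChannels ρ) :
    ‖h‖ * √ρ ∈ Set.Icc (1 / 2 : ℝ) 1 := by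
  have hs : 0 < √ρ := Real.sqrt_pos.2 hρ
  obtain ⟨h1, h2⟩ := norm_mem_Icc_of_mem_ball (by positivity) hh
  rw [← sub_div] at h1
  rw [← add_div] at h2
  constructor
  · rw [div_le_iff₀ hs] at h1
    linarith
  · rw [le_div_iff₀ hs] at h2
    linarith

theorem le_complexGaussian_weakChannels (hρ : 1 ≤ ρ) :
    Real.exp (-9) / 16 * (1 / ρ) ≤ complexGaussian.real (weakChannels ρ) := by
  have hs : 1 ≤ √ρ := Real.one_le_sqrt.2 hρ
  refine le_trans ?_ (le_complexGaussian_ball _ (by positivity))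
  have h1 : (1 / 4 / √ρ) ^ 2 = 1 / 16 * (1 / ρ) := by
    rw [div_pow, Real.sq_sqrt (by linarith)]
    ring
  have h2 : (3 / 4 / √ρ + 1 / 4 / √ρ) ^ 2 = 1 / ρ := by
    rw [← add_div, div_pow, Real.sq_sqrt (by linarith)]
    norm_num
  have h3 : 1 / ρ ≤ 9 := (div_le_one_of_le₀ hρ (by linarith)).trans (by norm_num)
  rw [Complex.norm_real, Real.norm_eq_abs, abs_of_nonneg (by positivity), h1, h2]
  have h4 : Real.exp (-9) ≤ Real.exp (-(1 / ρ)) := Real.exp_le_exp.2 (neg_le_neg h3)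
  calc Real.exp (-9) / 16 * (1 / ρ) = 1 / 16 * (1 / ρ) * Real.exp (-9) := by ring
    _ ≤ _ := by gcongr

theorem le_complexGaussian_ball_two_one :
    Real.exp (-9) / 16 ≤ complexGaussian.real (Metric.ball ((2 : ℝ) : ℂ) 1) := by
  refine le_trans ?_ (le_complexGaussian_ball _ zero_le_one)
  rw [Complex.norm_real, Real.norm_eq_abs, abs_of_nonneg zero_le_two]
  norm_num
  linarith [Real.exp_pos (-9)]

namespace NodeDetectors

variable (D : NodeDetectors S ρ)

theorem measurable_conditional_error {g : (Fin N → ℂ) → (Fin N → GF B) → Fin M}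
    (hg : ∀ w, Measurable fun h => g h w) (m : Fin M) :
    Measurable fun h => (gaussianVector N).real {n | g h (D.sent (m, h, n)) ≠ m} :=
  (measurable_measure_prodMk_left
    (measurable_prodMk_left (x := m) (D.measurableSet_error hg))).ennreal_toReal

/-- Whatever the decision for a received word `w` is, it is wrong for `m` or for `m'`. -/
theorem le_conditional_error_add {g : (Fin N → GF B) → Fin M} {h : Fin N → ℂ} {m m' : Fin M}
    (hne : m ≠ m') (w : Fin N → GF B) {κ : ℝ} (hκ : 0 ≤ κ)
    (h1 : ∀ i, κ ≤ D.transProb i (w i) m (h i)) (h2 : ∀ i, κ ≤ D.transProb i (w i) m' (h i)) :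
    κ ^ N ≤ (gaussianVector N).real {n | g (D.sent (m, h, n)) ≠ m} +
      (gaussianVector N).real {n | g (D.sent (m', h, n)) ≠ m'} := by
  have key : ∀ k, g w ≠ k → (∀ i, κ ≤ D.transProb i (w i) k (h i)) →
      κ ^ N ≤ (gaussianVector N).real {n | g (D.sent (k, h, n)) ≠ k} := by
    intro k hk hle
    calc κ ^ N = ∏ _i : Fin N, κ := by simp
      _ ≤ ∏ i, D.transProb i (w i) k (h i) := Finset.prod_le_prod (fun _ _ => hκ) fun i _ => hle i
      _ = (gaussianVector N).real {n | D.sent (k, h, n) = w} :=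
          (D.gaussianVector_sent_eq k h w).symm
      _ ≤ _ := measureReal_mono fun n (hn : D.sent (k, h, n) = w) => by
          rw [Set.mem_ofPred_eq, hn]
          exact hk
  by_cases hm : g w = m
  · have := key m' (fun h' => hne (hm.symm.trans h')) h2
    linarith [measureReal_nonneg (μ := gaussianVector N)
      (s := {n | g (D.sent (m, h, n)) ≠ m})]
  · have := key m hm h1
    linarith [measureReal_nonneg (μ := gaussianVector N)
      (s := {n | g (D.sent (m', h, n)) ≠ m'})]

/-- The lower bound holds for every decoder that knows the channels, whatever its decision rule. -/
theorem le_error {δ : ℝ} (hδ0 : 0 < δ) (hρ : 1 ≤ ρ) (hδ : S.Separated δ)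
    {g : (Fin N → ℂ) → (Fin N → GF B) → Fin M} (hgm : ∀ w, Measurable fun h => g h w)
    {m m' : Fin M} (hne : m ≠ m') :
    ((δ / 4) ^ 2 * Real.exp (-(‖S.point m - S.point m'‖ + δ / 4) ^ 2)) ^ N *
      ((Real.exp (-9) / 16) ^ N * (1 / ρ) ^ (S.diffNodes m m').card) / M ≤
      (law N M).real {ω | g ω.2.1 (D.sent ω) ≠ ω.1} := by
  have hρ0 : 0 < ρ := by linarith
  set κ : ℝ := (δ / 4) ^ 2 * Real.exp (-(‖S.point m - S.point m'‖ + δ / 4) ^ 2) with hκdef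
  have hκ : 0 ≤ κ := by positivity
  have hκself : κ ≤ (δ / 4) ^ 2 * Real.exp (-(‖S.point m - S.point m‖ + δ / 4) ^ 2) := by
    rw [sub_self, norm_zero, hκdef]
    gcongr
    exact norm_nonneg _
  have hκself' : κ ≤ (δ / 4) ^ 2 * Real.exp (-(‖S.point m' - S.point m'‖ + δ / 4) ^ 2) := by
    rwa [sub_self, ← sub_self (S.point m)]
  -- The nodes that distinguish `m` from `m'` are in a deep fade, the others have a good channel.
  set E : Set (Fin N → ℂ) := Set.pi Set.univ fun i =>
    if i ∈ S.diffNodes m m' then weakChannels ρ else Metric.ball ((2 : ℝ) : ℂ) 1 with hEdef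
  have hEmeas : MeasurableSet E := by
    refine MeasurableSet.univ_pi fun i => ?_
    split_ifs
    · exact measurableSet_ball
    · exact measurableSet_ball
  have hE : (Real.exp (-9) / 16) ^ N * (1 / ρ) ^ (S.diffNodes m m').card ≤
      (gaussianVector N).real E := by
    rw [measureReal_def, hEdef, Measure.pi_pi, ENNReal.toReal_prod]
    calc (Real.exp (-9) / 16) ^ N * (1 / ρ) ^ (S.diffNodes m m').card
        = ∏ i : Fin N, (Real.exp (-9) / 16 * if i ∈ S.diffNodes m m' then 1 / ρ else 1) := by
          rw [Finset.prod_mul_distrib, Finset.prod_ite_mem, Finset.univ_inter, Finset.prod_const,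
            Finset.prod_const, Finset.card_univ, Fintype.card_fin]
      _ ≤ _ := by
          refine Finset.prod_le_prod (fun i _ => ?_) fun i _ => ?_
          · split_ifs <;> positivity
          · split_ifs
            · exact le_complexGaussian_weakChannels hρ
            · rw [mul_one]
              exact le_complexGaussian_ball_two_one
  set f : Fin M → (Fin N → ℂ) → ℝ := fun k h =>
    (gaussianVector N).real {n | g h (D.sent (k, h, n)) ≠ k} with hfdef
  have hf0 : ∀ k h, 0 ≤ f k h := fun k h => measureReal_nonneg
  have hfint : ∀ k, Integrable (f k) (gaussianVector N) := fun k =>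
    Integrable.of_bound (D.measurable_conditional_error hgm k).aestronglyMeasurable 1
      (ae_of_all _ fun h => by
        rw [Real.norm_eq_abs, abs_of_nonneg (hf0 k h)]
        exact measureReal_le_one)
  have hle : ∀ h ∈ E, κ ^ N ≤ f m h + f m' h := by
    intro h hh
    have hh' : ∀ i, h i ∈
        if i ∈ S.diffNodes m m' then weakChannels ρ else Metric.ball ((2 : ℝ) : ℂ) 1 :=
      fun i => hh i (Set.mem_univ i)
    have hhalf : ∀ i, 1 / 2 ≤ ‖h i‖ * √ρ := by
      intro i
      have hi' := hh' i
      split_ifs at hi' with hi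
      · exact (norm_mul_sqrt_mem_Icc hρ0 hi').1
      · have h1 := (norm_mem_Icc_of_mem_ball zero_le_two hi').1
        nlinarith [Real.one_le_sqrt.2 hρ]
    refine D.le_conditional_error_add hne (codeword S.label S.gen m) hκ (fun i => ?_) fun i => ?_
    · exact hκself.trans (D.le_transProb hδ0.le hδ i m m (hhalf i) (Or.inr rfl))
    · have hi' := hh' i
      split_ifs at hi' with hi
      · exact D.le_transProb hδ0.le hδ i m m' (hhalf i)
          (Or.inl (norm_mul_sqrt_mem_Icc hρ0 hi').2)
      · rw [System.mem_diffNodes, not_not] at hi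
        rw [hi]
        exact hκself'.trans (D.le_transProb hδ0.le hδ i m' m' (hhalf i) (Or.inr rfl))
  rw [law_real_eq (D.measurableSet_error hgm)]
  refine div_le_div_of_nonneg_right ?_ (Nat.cast_nonneg M)
  calc _ ≤ κ ^ N * (gaussianVector N).real E :=
        mul_le_mul_of_nonneg_left hE (by positivity)
    _ = ∫ h, E.indicator (fun _ => κ ^ N) h ∂gaussianVector N := by
        rw [integral_indicator_const _ hEmeas, smul_eq_mul, mul_comm]
    _ ≤ ∫ h, f m h + f m' h ∂gaussianVector N := by
        refine integral_mono ((integrable_const _).indicator hEmeas)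
          ((hfint m).add (hfint m')) fun h => ?_
        by_cases hh : h ∈ E
        · simpa [hh] using hle h hh
        · simpa [hh] using add_nonneg (hf0 m h) (hf0 m' h)
    _ = ∑ k ∈ {m, m'}, ∫ h, f k h ∂gaussianVector N := by
        rw [integral_add (hfint m) (hfint m'), Finset.sum_pair hne]
    _ ≤ ∑ k, ∫ h, f k h ∂gaussianVector N :=
        Finset.sum_le_sum_of_subset_of_nonneg (Finset.subset_univ _) fun k _ _ =>
          integral_nonneg (hf0 k)

end NodeDetectors

/-! ### The diversity order -/

/-- Constant factors are negligible on the logarithmic scale. -/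
theorem hasDiversityOrder_of_le {Pe : ℝ → ℝ} {a b : ℝ} {d : ℕ} (ha : 0 < a) (hb : 0 < b)
    (h : ∀ ρ, 1 ≤ ρ → a * (1 / ρ) ^ d ≤ Pe ρ ∧ Pe ρ ≤ b * (1 / ρ) ^ d) :
    HasDiversityOrder Pe d := by
  have hlog : ∀ {c ρ : ℝ}, 0 < c → 1 < ρ →
      -(Real.log (c * (1 / ρ) ^ d) / Real.log ρ) = d - Real.log c / Real.log ρ := by
    intro c ρ hc hρ
    have := Real.log_pos hρ
    have hρ0 : ρ ≠ 0 := by positivity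
    rw [Real.log_mul hc.ne' (by positivity), Real.log_pow, one_div, Real.log_inv]
    field_simp
    ring
  have hlim : ∀ c : ℝ, Tendsto (fun ρ => (d : ℝ) - Real.log c / Real.log ρ) atTop (𝓝 d) := by
    intro c
    simpa using tendsto_const_nhds.sub
      ((tendsto_const_nhds (x := Real.log c)).div_atTop Real.tendsto_log_atTop)
  refine ⟨(eventually_ge_atTop 1).mono fun ρ hρ => lt_of_lt_of_le (by positivity) (h ρ hρ).1, ?_⟩
  refine tendsto_of_tendsto_of_tendsto_of_le_of_le' (hlim b) (hlim a) ?_ ?_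
  · filter_upwards [eventually_gt_atTop 1] with ρ hρ
    have h0 : 0 < Pe ρ := lt_of_lt_of_le (by positivity) (h ρ hρ.le).1
    have hl := Real.log_pos hρ
    rw [← hlog hb hρ]
    exact neg_le_neg (div_le_div_of_nonneg_right (Real.log_le_log h0 (h ρ hρ.le).2) hl.le)
  · filter_upwards [eventually_gt_atTop 1] with ρ hρ
    have hl := Real.log_pos hρ
    rw [← hlog ha hρ]
    exact neg_le_neg (div_le_div_of_nonneg_right
      (Real.log_le_log (by positivity) (h ρ hρ.le).1) hl.le)

/-- A decoder has diversity order `d_min(C)` as soon as it performs maximum likelihood decoding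
from a set of nodes, depending on the channels, that dominates all the nodes. -/
theorem hasDiversityOrder_of_dominates (hN : 0 < N) (hM : 2 ≤ M)
    (D : ∀ ρ : ℝ, NodeDetectors S ρ) (g : ℝ → (Fin N → ℂ) → (Fin N → GF B) → Fin M)
    (hgm : ∀ ρ w, Measurable fun h => g ρ h w)
    (hg : ∀ ρ h, ∃ T, S.Dominates T h ∧ ∀ w m, ∏ i ∈ T, (D ρ).transProb i (w i) m (h i) ≤
      ∏ i ∈ T, (D ρ).transProb i (w i) (g ρ h w) (h i)) :
    HasDiversityOrder (fun ρ => (law N M).real {ω | g ρ ω.2.1 ((D ρ).sent ω) ≠ ω.1}) S.dMin := by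
  obtain ⟨δ, hδ0, hδ⟩ := S.exists_separated
  obtain ⟨m, m', hne, hcard⟩ := System.exists_card_diffNodes_eq (S := S) hM
  have hM0 : (0 : ℝ) < M := by exact_mod_cast (by omega : 0 < M)
  have hN0 : (0 : ℝ) < N := by exact_mod_cast hN
  have hq : (0 : ℝ) < Fintype.card (GF B) := by exact_mod_cast Fintype.card_pos
  refine hasDiversityOrder_of_le
    (a := ((δ / 4) ^ 2 * Real.exp (-(‖S.point m - S.point m'‖ + δ / 4) ^ 2)) ^ N *
      (Real.exp (-9) / 16) ^ N / M)
    (b := M * (2 * Fintype.card (GF B)) ^ N * (16 * N / δ ^ 2) ^ S.dMin)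
    (by positivity) (by positivity) fun ρ hρ => ⟨?_, ?_⟩
  · refine le_trans (le_of_eq ?_) ((D ρ).le_error hδ0 hρ hδ (hgm ρ) hne)
    rw [hcard]
    ring
  · refine ((D ρ).error_le hδ0.le (by linarith) hδ (hgm ρ) (hg ρ)).trans ?_
    rw [mul_assoc _ ((16 * N / δ ^ 2) ^ S.dMin), ← mul_pow]
    have hρ0 : 0 < ρ := by linarith
    refine mul_le_mul_of_nonneg_left (pow_le_pow_left₀ (by positivity) ?_ _) (by positivity)
    have : 16 * N / δ ^ 2 * (1 / ρ) = 1 / (δ ^ 2 / 16 * ρ / N) := by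
      field_simp
    rw [this]
    exact one_div_le_one_div_of_le (by positivity) (by linarith)

/-! ### Minimum distance of a repeated code -/

theorem hammingDist_of_repeat {α : Type*} [DecidableEq α] {q L : ℕ} {x y : Fin (q * L) → α}
    {x' y' : Fin L → α} (hx : ∀ (i : Fin q) (j : Fin L), x (finProdFinEquiv (i, j)) = x' j)
    (hy : ∀ (i : Fin q) (j : Fin L), y (finProdFinEquiv (i, j)) = y' j) :
    hammingDist x y = q * hammingDist x' y' := by
  rw [hammingDist, hammingDist, Finset.card_filter, Finset.card_filter,
    ← Equiv.sum_comp finProdFinEquiv, Fintype.sum_prod_type]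
  simp_rw [hx, hy]
  rw [Finset.sum_const, Finset.card_univ, Fintype.card_fin, smul_eq_mul]

theorem dMin_eq_mul_dMinFirst {q L : ℕ} (hL : L ≤ q * L) (hM : 2 ≤ M)
    (S : System (q * L) M K B) (hrep : S.RulesRepeat L) :
    S.dMin = q * S.dMinFirst L hL := by
  classical
  set c := codeword S.label S.gen with hc
  set c' := codeword S.label (S.gen.submatrix id (Fin.castLE hL)) with hc'
  have hcol : ∀ m (i : Fin q) (j : Fin L), c m (finProdFinEquiv (i, j)) = c' m j := by
    intro m i j
    have h := hrep.1 (finProdFinEquiv (i, j)) (Fin.castLE hL j) (by simp)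
    exact congrArg (fun v => S.label m ⬝ᵥ v) h
  have hdist : ∀ m m', hammingDist (c m) (c m') = q * hammingDist (c' m) (c' m') := fun m m' =>
    hammingDist_of_repeat (hcol m) (hcol m')
  have hne : ∀ {n : ℕ} (e : Fin M → Fin n → GF B),
      {d | ∃ m m' : Fin M, m ≠ m' ∧ d = hammingDist (e m) (e m')}.Nonempty := fun e =>
    ⟨_, ⟨0, by omega⟩, ⟨1, by omega⟩, by simp, rfl⟩
  apply le_antisymm
  · obtain ⟨m, m', hmm, hd⟩ := Nat.sInf_mem (hne c')
    calc S.dMin ≤ hammingDist (c m) (c m') := by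
          exact Nat.sInf_le ⟨m, m', hmm, rfl⟩
      _ = q * hammingDist (c' m) (c' m') := hdist m m'
      _ = q * S.dMinFirst L hL := by
          rw [← hd, System.dMinFirst, minDist]
  · obtain ⟨m, m', hmm, hd⟩ := Nat.sInf_mem (hne c)
    calc q * S.dMinFirst L hL ≤ q * hammingDist (c' m) (c' m') := by
          refine Nat.mul_le_mul_left q ?_
          exact Nat.sInf_le ⟨m, m', hmm, rfl⟩
      _ = hammingDist (c m) (c m') := (hdist m m').symm
      _ = S.dMin := by
          rw [← hd, System.dMin, minDist]

/-! ### The two decoders -/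

theorem System.two_le_card (S : System N M K B) (hK : 0 < K) : 2 ≤ M := by
  have : Nonempty (Fin K) := ⟨⟨0, hK⟩⟩
  have : Nontrivial (Fin M) := S.label.nontrivial
  exact Fin.nontrivial_iff_two_le.1 inferInstance

theorem SubsetMLDecoder.select_injective {D : NodeDetectors S ρ} {L : ℕ}
    (R : SubsetMLDecoder D L) (h : Fin N → ℂ) : Function.Injective (R.select h) := by
  intro j k hjk
  rw [Fin.ext_iff, ← R.select_mem h j, ← R.select_mem h k, hjk]

/-- Each group is represented by its strongest node, so the selected nodes dominate. -/
theorem SubsetMLDecoder.dominates_select {D : NodeDetectors S ρ} {L : ℕ}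
    (R : SubsetMLDecoder D L) (hL : 0 < L) (hrep : S.RulesRepeat L) (h : Fin N → ℂ) :
    S.Dominates (Finset.univ.image (R.select h)) h := by
  intro k
  let j : Fin L := ⟨(k : ℕ) % L, Nat.mod_lt _ hL⟩
  exact ⟨R.select h j, Finset.mem_image_of_mem _ (Finset.mem_univ j),
    hrep.1 _ _ (R.select_mem h j).symm, R.select_max h j k rfl⟩

theorem SubsetMLDecoder.measurable_decode_select {D : NodeDetectors S ρ} {L : ℕ}
    (R : SubsetMLDecoder D L) (w : Fin N → GF B) :
    Measurable fun h => R.decode h fun j => w (R.select h j) := by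
  -- Split according to the selection, which takes finitely many values.
  have hsel : Measurable R.select := measurable_pi_lambda _ R.measurable_select
  refine measurable_to_countable' fun m => ?_
  have : (fun h => R.decode h fun j => w (R.select h j)) ⁻¹' {m} =
      ⋃ σ : Fin L → Fin N, R.select ⁻¹' {σ} ∩ (fun h => R.decode h (w ∘ σ)) ⁻¹' {m} := by
    ext h
    simp [Function.comp_def]
  rw [this]
  exact MeasurableSet.iUnion fun σ => (hsel (measurableSet_singleton σ)).inter
    (R.measurable_decode _ (measurableSet_singleton m))

end CodedDiversity

theorem lemma2 {N M K B L : ℕ} (hN : 0 < N) (hK : 0 < K) (hB : 0 < B)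
    (S : CodedDiversity.System N M K B) (hLN : L ∣ N) (hrep : S.RulesRepeat L)
    (D : ∀ ρ : ℝ, CodedDiversity.NodeDetectors S ρ)
    (ml : ∀ ρ : ℝ, CodedDiversity.MLDecoder (D ρ))
    (sub : ∀ ρ : ℝ, CodedDiversity.SubsetMLDecoder (D ρ) L) :
    S.dMin = N / L * S.dMinFirst L (Nat.le_of_dvd hN hLN) ∧
    CodedDiversity.HasDiversityOrder (fun ρ => (sub ρ).errorProb) (S.dMin : ℝ) ∧
    CodedDiversity.HasDiversityOrder (fun ρ => (ml ρ).errorProb) (S.dMin : ℝ) := by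
  have hM : 2 ≤ M := S.two_le_card hK
  have hL : 0 < L := Nat.pos_of_dvd_of_pos hLN hN
  refine ⟨?_, ?_, ?_⟩
  · obtain ⟨q, rfl⟩ := exists_eq_mul_left_of_dvd hLN
    rw [Nat.mul_div_cancel _ hL]
    exact CodedDiversity.dMin_eq_mul_dMinFirst _ hM S hrep
  · refine CodedDiversity.hasDiversityOrder_of_dominates hN hM D
      (fun ρ h w => (sub ρ).decode h fun j => w ((sub ρ).select h j))
      (fun ρ w => (sub ρ).measurable_decode_select w) fun ρ h =>
        ⟨_, (sub ρ).dominates_select hL hrep h, fun w m => ?_⟩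
    rw [Finset.prod_image ((sub ρ).select_injective h).injOn,
      Finset.prod_image ((sub ρ).select_injective h).injOn]
    exact (sub ρ).decode_max h _ m
  · exact CodedDiversity.hasDiversityOrder_of_dominates hN hM D (fun ρ => (ml ρ).decode)
      (fun ρ w => (ml ρ).measurable_decode w) fun ρ h =>
        ⟨Finset.univ, fun k => ⟨k, Finset.mem_univ k, rfl, le_rfl⟩,
          fun w m => (ml ρ).decode_max h w m⟩
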